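/- Let $\mathcal C$ be a braided monoidal category with equalizers and coequalizers, with tensor product $\otimes$, unit object $K$ and braiding $c$; associativity and unit constraints are suppressed, and an object also denotes its identity morphism. Let $H$ be an object with a unital magma structure ($\eta:K\to H$, $\mu:H\otimes H\to H$ with $\mu\circ(\eta\otimes H)=\mathrm{id}_H=\mu\circ(H\otimes\eta)$) and a comonoid structure (counit $\varepsilon:H\to K$, coassociative coproduct $\delta:H\to H\otimes H$) such that (a1) $\delta\circ\mu=(\mu\otimes\mu)\circ(H\otimes c_{H,H}\otimes H)\circ(\delta\otimes\delta)$; (a2) $\varepsilon\circ\mu\circ(\mu\otimes H)=\varepsilon\circ\mu\circ(H\otimes\mu)=((\varepsilon\circ\mu)\otimes(\varepsilon\circ\mu))\circ(H\otimes\delta\otimes H)=((\varepsilon\circ\mu)\otimes(\varepsilon\circ\mu))\circ(H\otimes(c_{H,H}^{-1}\circ\delta)\otimes H)$; (a3) $(\delta\otimes H)\circ\delta\circ\eta=(H\otimes\mu\otimes H)\circ((\delta\circ\eta)\otimes(\delta\circ\eta))=(H\otimes(\mu\circ c_{H,H}^{-1})\otimes H)\circ((\delta\circ\eta)\otimes(\delta\circ\eta))$.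 Put $\Pi^L=((\varepsilon\circ\mu)\otimes H)\circ(H\otimes c_{H,H})\circ((\delta\circ\eta)\otimes H)$ and $\Pi^R=(H\otimes(\varepsilon\circ\mu))\circ(c_{H,H}\otimes H)\circ(H\otimes(\delta\circ\eta))$, and write $u*v=\mu\circ(u\otimes v)\circ\delta$ for $u,v:H\to H$. $H$ is called a weak Hopf quasigroup if moreover there is $\lambda:H\to H$ with $\Pi^L=\mathrm{id}_H*\lambda$; $\Pi^R=\lambda*\mathrm{id}_H$; $\lambda*\Pi^L=\Pi^R*\lambda=\lambda$; $\mu\circ(\lambda\otimes\mu)\circ(\delta\otimes H)=\mu\circ(\Pi^R\otimes H)$; $\mu\circ(H\otimes\mu)\circ(H\otimes\lambda\otimes H)\circ(\delta\otimes H)=\mu\circ(\Pi^L\otimes H)$; $\mu\circ(\mu\otimes\lambda)\circ(H\otimes\delta)=\mu\circ(H\otimes\Pi^L)$; $\mu\circ(\mu\otimes H)\circ(H\otimes\lambda\otimes H)\circ(H\otimes\delta)=\mu\circ(H\otimes\Pi^R)$. For $\sigma\in\{L,R\}$ let $\Omega_\sigma^1=(\mu\otimes H)\circ(H\otimes\Pi^\sigma\otimes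 H)\circ(H\otimes\delta)$ and $\Omega_\sigma^2=(H\otimes\mu)\circ(H\otimes\Pi^\sigma\otimes H)\circ(\delta\otimes H)$. Let $\beta=(\mu\otimes H)\circ(H\otimes\delta)$ and $\gamma=(H\otimes\mu)\circ(\delta\otimes H)$ be the right and left Galois morphisms. A morphism $\phi:H\otimes H\to H\otimes H$ is almost left $H$-linear if $\phi=(\mu\otimes H)\circ(H\otimes\phi)\circ(H\otimes\eta\otimes H)$, and almost right $H$-linear if $\phi=(H\otimes\mu)\circ(\phi\otimes H)\circ(H\otimes\eta\otimes H)$. Then the four morphisms $\Omega_\sigma^\alpha$ ($\sigma\in\{L,R\}$, $\alpha\in\{1,2\}$) are split idempotents, i.e. there are an object $H\times_\sigma^\alpha H$ and morphisms $q_\sigma^\alpha:H\otimes H\to H\times_\sigma^\alpha H$, $j_\sigma^\alpha:H\times_\sigma^\alpha H\to H\otimes H$ with $j_\sigma^\alpha\circ q_\sigma^\alpha=\Omega_\sigma^\alpha$ and $q_\sigma^\alpha\circ j_\sigma^\alpha=\mathrm{id}$; and, for any choice of such splittings, the following are equivalent: (i) $H$ is a weak Hopf quasigroup; (ii) the morphisms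 $f=q_R^1\circ\beta\circ j_L^1:H\times_L^1H\to H\times_R^1H$ and $g=q_L^2\circ\gamma\circ j_R^2:H\times_R^2H\to H\times_L^2H$ are isomorphisms, $j_L^1\circ f^{-1}\circ q_R^1$ is almost left $H$-linear, and $j_R^2\circ g^{-1}\circ q_L^2$ is almost right $H$-linear. -/

import Mathlib

open CategoryTheory
open scoped MonoidalCategory

namespace WeakHopfQuasigroup

open scoped ComonObj

universe v u

variable {C : Type u} [Category.{v} C] [MonoidalCategory C]

/-- A unital magma in a monoidal category: an object with a unit and a (not necessarily
associative) product for which the unit is two-sided. -/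
class UnitalMagmaObj (H : C) where
  /-- the unit -/
  one : 𝟙_ C ⟶ H
  /-- the product -/
  mul : H ⊗ H ⟶ H
  one_mul : one ▷ H ≫ mul = (λ_ H).hom
  mul_one : H ◁ one ≫ mul = (ρ_ H).hom

/-- The unit of a unital magma. -/
abbrev eta (H : C) [UnitalMagmaObj H] : 𝟙_ C ⟶ H := UnitalMagmaObj.one

/-- The product of a unital magma. -/
abbrev mu (H : C) [UnitalMagmaObj H] : H ⊗ H ⟶ H := UnitalMagmaObj.mul

/-- A splitting of an endomorphism `e`: `e = j ∘ q` and `q ∘ j = id`. -/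
structure Splitting {X : C} (e : X ⟶ X) where
  /-- the object through which `e` factors -/
  obj : C
  /-- the projection -/
  q : X ⟶ obj
  /-- the inclusion -/
  j : obj ⟶ X
  q_j : q ≫ j = e
  j_q : j ≫ q = 𝟙 obj

section Linearity

variable (H : C) [UnitalMagmaObj H]

/-- `φ = (μ ⊗ H) ∘ (H ⊗ φ) ∘ (H ⊗ η ⊗ H)`. -/
def AlmostLeftLinear (φ : H ⊗ H ⟶ H ⊗ H) : Prop :=
  φ = H ◁ (λ_ H).inv ≫ H ◁ (eta H ▷ H) ≫ H ◁ φ ≫ (α_ H H H).inv ≫ mu H ▷ H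

/-- `φ = (H ⊗ μ) ∘ (φ ⊗ H) ∘ (H ⊗ η ⊗ H)`. -/
def AlmostRightLinear (φ : H ⊗ H ⟶ H ⊗ H) : Prop :=
  φ = (ρ_ H).inv ▷ H ≫ (H ◁ eta H) ▷ H ≫ φ ▷ H ≫ (α_ H H H).hom ≫ H ◁ mu H

end Linearity

section Galois

variable (H : C) [UnitalMagmaObj H] [ComonObj H]

/-- The convolution product `f ∗ g = μ ∘ (f ⊗ g) ∘ δ`. -/
def conv (f g : H ⟶ H) : H ⟶ H := Δ[H] ≫ (f ⊗ₘ g) ≫ mu H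

/-- The right Galois morphism `(μ ⊗ H) ∘ (H ⊗ δ)`. -/
def rightGalois : H ⊗ H ⟶ H ⊗ H :=
  H ◁ Δ[H] ≫ (α_ H H H).inv ≫ mu H ▷ H

/-- The left Galois morphism `(H ⊗ μ) ∘ (δ ⊗ H)`. -/
def leftGalois : H ⊗ H ⟶ H ⊗ H :=
  Δ[H] ▷ H ≫ (α_ H H H).hom ≫ H ◁ mu H

/-- `(μ ⊗ H) ∘ (H ⊗ p ⊗ H) ∘ (H ⊗ δ)`. -/
def omegaOne (p : H ⟶ H) : H ⊗ H ⟶ H ⊗ H :=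
  H ◁ Δ[H] ≫ H ◁ (p ▷ H) ≫ (α_ H H H).inv ≫ mu H ▷ H

/-- `(H ⊗ μ) ∘ (H ⊗ p ⊗ H) ∘ (δ ⊗ H)`. -/
def omegaTwo (p : H ⟶ H) : H ⊗ H ⟶ H ⊗ H :=
  Δ[H] ▷ H ≫ (H ◁ p) ▷ H ≫ (α_ H H H).hom ≫ H ◁ mu H

end Galois

section Braided

variable [BraidedCategory C] (H : C) [UnitalMagmaObj H] [ComonObj H]

/-- The target morphism
`Π^L = ((ε ∘ μ) ⊗ H) ∘ (H ⊗ c) ∘ ((δ ∘ η) ⊗ H)`. -/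
def piL : H ⟶ H :=
  (λ_ H).inv ≫ (eta H ≫ Δ[H]) ▷ H ≫ (α_ H H H).hom ≫ H ◁ (β_ H H).hom ≫
    (α_ H H H).inv ≫ (mu H ≫ ε[H]) ▷ H ≫ (λ_ H).hom

/-- The source morphism
`Π^R = (H ⊗ (ε ∘ μ)) ∘ (c ⊗ H) ∘ (H ⊗ (δ ∘ η))`. -/
def piR : H ⟶ H :=
  (ρ_ H).inv ≫ H ◁ (eta H ≫ Δ[H]) ≫ (α_ H H H).inv ≫ (β_ H H).hom ▷ H ≫
    (α_ H H H).hom ≫ H ◁ (mu H ≫ ε[H]) ≫ (ρ_ H).hom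

/-- `Ω_L^1`. -/
def omegaL1 : H ⊗ H ⟶ H ⊗ H := omegaOne H (piL H)

/-- `Ω_R^1`. -/
def omegaR1 : H ⊗ H ⟶ H ⊗ H := omegaOne H (piR H)

/-- `Ω_L^2`. -/
def omegaL2 : H ⊗ H ⟶ H ⊗ H := omegaTwo H (piL H)

/-- `Ω_R^2`. -/
def omegaR2 : H ⊗ H ⟶ H ⊗ H := omegaTwo H (piR H)

/-- The axioms (a1), (a2), (a3) on a unital magma and comonoid `H`. -/
structure AxiomsA123 : Prop where
  /-- `δ ∘ μ = (μ ⊗ μ) ∘ δ_{H ⊗ H}` -/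
  a1 : mu H ≫ Δ[H] = ((Δ[H] ⊗ₘ Δ[H]) ≫ MonoidalCategory.tensorμ H H H H) ≫ (mu H ⊗ₘ mu H)
  /-- `ε ∘ μ ∘ (μ ⊗ H) = ε ∘ μ ∘ (H ⊗ μ)` -/
  a2_assoc : mu H ▷ H ≫ mu H ≫ ε[H] =
    (α_ H H H).hom ≫ H ◁ mu H ≫ mu H ≫ ε[H]
  /-- `ε ∘ μ ∘ (μ ⊗ H) = ((ε ∘ μ) ⊗ (ε ∘ μ)) ∘ (H ⊗ δ ⊗ H)` -/
  a2_comul : mu H ▷ H ≫ mu H ≫ ε[H] =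
    (H ◁ Δ[H]) ▷ H ≫ (α_ H H H).inv ▷ H ≫ (α_ (H ⊗ H) H H).hom ≫
      ((mu H ≫ ε[H]) ⊗ₘ (mu H ≫ ε[H])) ≫ (λ_ (𝟙_ C)).hom
  /-- `ε ∘ μ ∘ (μ ⊗ H) = ((ε ∘ μ) ⊗ (ε ∘ μ)) ∘ (H ⊗ (c⁻¹ ∘ δ) ⊗ H)` -/
  a2_braid : mu H ▷ H ≫ mu H ≫ ε[H] =
    (H ◁ (Δ[H] ≫ (β_ H H).inv)) ▷ H ≫ (α_ H H H).inv ▷ H ≫ (α_ (H ⊗ H) H H).hom ≫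
      ((mu H ≫ ε[H]) ⊗ₘ (mu H ≫ ε[H])) ≫ (λ_ (𝟙_ C)).hom
  /-- `(δ ⊗ H) ∘ δ ∘ η = (H ⊗ μ ⊗ H) ∘ ((δ ∘ η) ⊗ (δ ∘ η))` -/
  a3_mul : eta H ≫ Δ[H] ≫ Δ[H] ▷ H =
    (λ_ (𝟙_ C)).inv ≫ ((eta H ≫ Δ[H]) ⊗ₘ (eta H ≫ Δ[H])) ≫
      (α_ (H ⊗ H) H H).inv ≫ (α_ H H H).hom ▷ H ≫ (H ◁ mu H) ▷ H
  /-- `(δ ⊗ H) ∘ δ ∘ η = (H ⊗ (μ ∘ c⁻¹) ⊗ H) ∘ ((δ ∘ η) ⊗ (δ ∘ η))` -/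
  a3_braid : eta H ≫ Δ[H] ≫ Δ[H] ▷ H =
    (λ_ (𝟙_ C)).inv ≫ ((eta H ≫ Δ[H]) ⊗ₘ (eta H ≫ Δ[H])) ≫
      (α_ (H ⊗ H) H H).inv ≫ (α_ H H H).hom ▷ H ≫ (H ◁ ((β_ H H).inv ≫ mu H)) ▷ H

/-- The conditions (a4-1) to (a4-7): `s` is an antipode of `H`. -/
structure IsAntipode (s : H ⟶ H) : Prop where
  /-- `Π^L = id ∗ s` -/
  id_conv : piL H = conv H (𝟙 H) s
  /-- `Π^R = s ∗ id` -/
  conv_id : piR H = conv H s (𝟙 H)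
  /-- `s ∗ Π^L = s` -/
  conv_piL : conv H s (piL H) = s
  /-- `Π^R ∗ s = s` -/
  piR_conv : conv H (piR H) s = s
  /-- `μ ∘ (s ⊗ μ) ∘ (δ ⊗ H) = μ ∘ (Π^R ⊗ H)` -/
  a4_4 : Δ[H] ▷ H ≫ (α_ H H H).hom ≫ (s ⊗ₘ mu H) ≫ mu H = piR H ▷ H ≫ mu H
  /-- `μ ∘ (H ⊗ μ) ∘ (H ⊗ s ⊗ H) ∘ (δ ⊗ H) = μ ∘ (Π^L ⊗ H)` -/
  a4_5 : Δ[H] ▷ H ≫ (H ◁ s) ▷ H ≫ (α_ H H H).hom ≫ H ◁ mu H ≫ mu H = piL H ▷ H ≫ mu H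
  /-- `μ ∘ (μ ⊗ s) ∘ (H ⊗ δ) = μ ∘ (H ⊗ Π^L)` -/
  a4_6 : H ◁ Δ[H] ≫ (α_ H H H).inv ≫ (mu H ⊗ₘ s) ≫ mu H = H ◁ piL H ≫ mu H
  /-- `μ ∘ (μ ⊗ H) ∘ (H ⊗ s ⊗ H) ∘ (H ⊗ δ) = μ ∘ (H ⊗ Π^R)` -/
  a4_7 : H ◁ Δ[H] ≫ H ◁ (s ▷ H) ≫ (α_ H H H).inv ≫ mu H ▷ H ≫ mu H = H ◁ piR H ≫ mu H

/-- A unital magma and comonoid `H` is a weak Hopf quasigroup: it satisfies (a1), (a2), (a3)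
and has an antipode. -/
structure IsWeakHopfQuasigroup : Prop extends AxiomsA123 H where
  exists_antipode : ∃ s : H ⟶ H, IsAntipode H s

variable {H}

/-- `f = q_R^1 ∘ β ∘ j_L^1`, where `β` is the right Galois morphism. -/
def fMor (L1 : Splitting (omegaL1 H)) (R1 : Splitting (omegaR1 H)) : L1.obj ⟶ R1.obj :=
  L1.j ≫ rightGalois H ≫ R1.q

/-- `g = q_L^2 ∘ γ ∘ j_R^2`, where `γ` is the left Galois morphism. -/
def gMor (R2 : Splitting (omegaR2 H)) (L2 : Splitting (omegaL2 H)) : R2.obj ⟶ L2.obj :=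
  R2.j ≫ leftGalois H ≫ L2.q

end Braided

end WeakHopfQuasigroup

/-!
Galois-type characterization of weak Hopf quasigroups in a braided monoidal category.
-/

open CategoryTheory
open scoped MonoidalCategory

namespace WeakHopfQuasigroup

open scoped ComonObj
open MonoidalCategory

universe v u

/-! ### Colinear extensions and their composition -/

section Extension

variable {C : Type u} [Category.{v} C] [MonoidalCategory C] {H X Y : C}

/-! The maps `β`, `Ω_L^1`, `Ω_R^1` are all colinear extensions `rightExt Δ a` of maps `a : H ⊗ H ⟶
H`; `γ`, `Ω_R^2`, `Ω_L^2` are the mirror `leftExt Δ a`. An extension determines `a` (apply the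
counit) and extensions compose by a simple rule, so identities between these maps reduce to
identities with values in `H`.

Two facts about the projections follow from (a1)-(a3): `Π^L` and `Π^R` are nuclear on both sides,
and they satisfy absorption laws such as `x Π^L(y₁) y₂ = x y`. They make each `Ω` idempotent and
give `Ω_L^1 ≫ β = β = β ≫ Ω_R^1`, and similarly for `γ`. Hence `f` is invertible exactly when `β`
has an inverse `φ` relative to these idempotents (`IsRelativeInverse`), with `φ = j ∘ f⁻¹ ∘ q`.

Given an antipode `s`, `φ` is the extension of `x ⊗ y ↦ x s(y)`. Conversely `φ` is colinear because
`β` is (`eq_rightExt_of_isRelativeInverse`), so almost linearity forces that shape, with `s` read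
off at the unit; the four equations for `φ` then become the antipode identities. The `s` from `f`
and the `r` from `g` agree by a one-line convolution argument (`IsRightAntipode.eq`). -/

/-- `(a ⊗ H) ∘ (H ⊗ d)`. -/
def rightExt (d : H ⟶ H ⊗ H) (a : H ⊗ H ⟶ X) : H ⊗ H ⟶ X ⊗ H :=
  H ◁ d ≫ (α_ H H H).inv ≫ a ▷ H

/-- `(H ⊗ a) ∘ (d ⊗ H)`. -/
def leftExt (d : H ⟶ H ⊗ H) (a : H ⊗ H ⟶ X) : H ⊗ H ⟶ H ⊗ X :=
  d ▷ H ≫ (α_ H H H).hom ≫ H ◁ a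

lemma rightExt_comp_whiskerRight (d : H ⟶ H ⊗ H) (a : H ⊗ H ⟶ X) (f : X ⟶ Y) :
    rightExt d a ≫ f ▷ H = rightExt d (a ≫ f) := by
  simp [rightExt]

lemma leftExt_comp_whiskerLeft (d : H ⟶ H ⊗ H) (a : H ⊗ H ⟶ X) (f : X ⟶ Y) :
    leftExt d a ≫ H ◁ f = leftExt d (a ≫ f) := by
  simp [leftExt]

lemma whiskerLeft_comp_rightExt (d : H ⟶ H ⊗ H) (hd : d ≫ d ▷ H ≫ (α_ H H H).hom = d ≫ H ◁ d)
    (a : H ⊗ H ⟶ X) :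
    rightExt d a ≫ X ◁ d = rightExt d (rightExt d a) ≫ (α_ X H H).hom := by
  have h : d ≫ d ▷ H = d ≫ H ◁ d ≫ (α_ H H H).inv := by
    rw [← Category.assoc, ← hd]; simp
  calc rightExt d a ≫ X ◁ d
      = H ◁ d ≫ (α_ H H H).inv ≫ (a ▷ H ≫ X ◁ d) := by simp [rightExt]
    _ = H ◁ (d ≫ H ◁ d ≫ (α_ H H H).inv) ⊗≫ a ▷ H ▷ H ⊗≫ 𝟙 _ := by
        rw [← whisker_exchange]; monoidal
    _ = _ := by rw [← h]; simp only [rightExt]; monoidal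

/-- Coassociativity makes an extension a comodule map into a cofree comodule, and such a map is
fixed by its `X`-component. -/
lemma rightExt_comp_rightExt (d : H ⟶ H ⊗ H) (hd : d ≫ d ▷ H ≫ (α_ H H H).hom = d ≫ H ◁ d)
    (a : H ⊗ H ⟶ H) (b : H ⊗ H ⟶ X) :
    rightExt d a ≫ rightExt d b = rightExt d (rightExt d a ≫ b) := by
  calc _ = (rightExt d a ≫ H ◁ d) ≫ (α_ H H H).inv ≫ b ▷ H := by simp [rightExt]
    _ = _ := by
      rw [whiskerLeft_comp_rightExt d hd, Category.assoc, Iso.hom_inv_id_assoc,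
        rightExt_comp_whiskerRight]

lemma whiskerRight_comp_leftExt (d : H ⟶ H ⊗ H) (hd : d ≫ d ▷ H ≫ (α_ H H H).hom = d ≫ H ◁ d)
    (a : H ⊗ H ⟶ X) :
    leftExt d a ≫ d ▷ X = leftExt d (leftExt d a) ≫ (α_ H H X).inv := by
  calc leftExt d a ≫ d ▷ X
      = d ▷ H ≫ (α_ H H H).hom ≫ (H ◁ a ≫ d ▷ X) := by simp [leftExt]
    _ = (d ≫ d ▷ H ≫ (α_ H H H).hom) ▷ H ⊗≫ H ◁ H ◁ a ⊗≫ 𝟙 _ := by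
        rw [whisker_exchange]; monoidal
    _ = _ := by rw [hd]; simp only [leftExt]; monoidal

lemma leftExt_comp_leftExt (d : H ⟶ H ⊗ H) (hd : d ≫ d ▷ H ≫ (α_ H H H).hom = d ≫ H ◁ d)
    (a : H ⊗ H ⟶ H) (b : H ⊗ H ⟶ X) :
    leftExt d a ≫ leftExt d b = leftExt d (leftExt d a ≫ b) := by
  calc _ = (leftExt d a ≫ d ▷ H) ≫ (α_ H H H).hom ≫ H ◁ b := by simp [leftExt]
    _ = _ := by
      rw [whiskerRight_comp_leftExt d hd, Category.assoc, Iso.inv_hom_id_assoc,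
        leftExt_comp_whiskerLeft]

end Extension

/-! ### Counit contractions for an abstract weak coproduct -/

section Coproduct

variable {C : Type u} [Category.{v} C] [MonoidalCategory C] {H X : C}

/-- The middle-four exchange induced by `t`. -/
def middle (t : H ⊗ H ⟶ H ⊗ H) : (H ⊗ H) ⊗ (H ⊗ H) ⟶ (H ⊗ H) ⊗ (H ⊗ H) :=
  (α_ H H (H ⊗ H)).hom ≫ H ◁ ((α_ H H H).inv ≫ t ▷ H ≫ (α_ H H H).hom) ≫
    (α_ H H (H ⊗ H)).inv

variable (H) [UnitalMagmaObj H] [ComonObj H]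

/-- The composite of the product and the counit. -/
abbrev counitMul : H ⊗ H ⟶ 𝟙_ C := mu H ≫ ε[H]

/-- A coassociative coproduct `d` with counit `ε` for which `μ` is comultiplicative with respect to
the exchange `t`, and `ε ∘ μ` satisfies the weak counit condition. -/
structure IsWeakCoproduct (d : H ⟶ H ⊗ H) (t : H ⊗ H ⟶ H ⊗ H) : Prop where
  counit_left : d ≫ ε[H] ▷ H = (λ_ H).inv
  counit_right : d ≫ H ◁ ε[H] = (ρ_ H).inv
  coassoc : d ≫ d ▷ H ≫ (α_ H H H).hom = d ≫ H ◁ d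
  mul_comul : mu H ≫ d = d ▷ H ≫ (H ⊗ H) ◁ d ≫ middle t ≫ mu H ▷ (H ⊗ H) ≫ H ◁ mu H
  mul_mul_counit : mu H ▷ H ≫ counitMul H =
    rightExt d (counitMul H) ▷ H ≫ (λ_ H).hom ▷ H ≫ counitMul H
  assoc_counit : mu H ▷ H ≫ counitMul H = (α_ H H H).hom ≫ H ◁ mu H ≫ counitMul H

variable {H}

/-- `x ⊗ y ↦ ε(x y₁) y₂`. -/
def contractLeft (d : H ⟶ H ⊗ H) : H ⊗ H ⟶ H := rightExt d (counitMul H) ≫ (λ_ H).hom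

/-- `x ⊗ y ↦ x₁ ε(x₂ y)`. -/
def contractRight (d : H ⟶ H ⊗ H) : H ⊗ H ⟶ H := leftExt d (counitMul H) ≫ (ρ_ H).hom

/-- Both sides are `x₁ ⊗ ε(x₂ y₁) y₂`, with `x` split by `d'` and `y` by `d`. This is the bridge
between left and right extensions. -/
lemma leftExt_contractLeft (d d' : H ⟶ H ⊗ H) :
    leftExt d' (contractLeft d) = rightExt d (contractRight d') := by
  calc leftExt d' (contractLeft d)
      = (d' ▷ H ≫ (H ⊗ H) ◁ d) ⊗≫ H ◁ counitMul H ▷ H ⊗≫ 𝟙 _ := by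
        simp only [leftExt, contractLeft, rightExt]; monoidal
    _ = _ := by
        rw [← whisker_exchange]; simp only [leftExt, contractRight, rightExt]; monoidal

namespace IsWeakCoproduct

variable {d : H ⟶ H ⊗ H} {t : H ⊗ H ⟶ H ⊗ H}

lemma mul_eq_left (h : IsWeakCoproduct H d t) :
    mu H = d ▷ H ≫ (H ⊗ H) ◁ d ≫ middle t ≫ counitMul H ▷ (H ⊗ H) ≫ (λ_ _).hom ≫ mu H := by
  calc mu H = (mu H ≫ d) ≫ ε[H] ▷ H ≫ (λ_ H).hom := by
        rw [Category.assoc, reassoc_of% h.counit_left]; simp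
    _ = d ▷ H ≫ (H ⊗ H) ◁ d ≫ middle t ≫ mu H ▷ (H ⊗ H) ≫
          (H ◁ mu H ≫ ε[H] ▷ H) ≫ (λ_ H).hom := by rw [h.mul_comul]; simp
    _ = _ := by rw [whisker_exchange]; simp

lemma mul_eq_right (h : IsWeakCoproduct H d t) :
    mu H = d ▷ H ≫ (H ⊗ H) ◁ d ≫ middle t ≫ (H ⊗ H) ◁ counitMul H ≫ (ρ_ _).hom ≫ mu H := by
  calc mu H = (mu H ≫ d) ≫ H ◁ ε[H] ≫ (ρ_ H).hom := by
        rw [Category.assoc, reassoc_of% h.counit_right]; simp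
    _ = d ▷ H ≫ (H ⊗ H) ◁ d ≫ middle t ≫ (mu H ▷ (H ⊗ H) ≫ H ◁ mu H) ≫
          H ◁ ε[H] ≫ (ρ_ H).hom := by rw [h.mul_comul]; simp
    _ = d ▷ H ≫ (H ⊗ H) ◁ d ≫ middle t ≫ (H ⊗ H) ◁ mu H ≫
          (mu H ▷ H ≫ H ◁ ε[H]) ≫ (ρ_ H).hom := by rw [← whisker_exchange]; simp
    _ = _ := by rw [← whisker_exchange]; simp

/-- In Sweedler notation, suppressing the exchange: `ε(x(y₁z₁)) y₂z₂ = ε(x y₁) ε(y₂z₁) y₃z₂`, and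
the last two factors collapse to `y₂ z` by `mul_eq_left`. This is the source of nuclearity. -/
lemma mul_contractLeft (h : IsWeakCoproduct H d t) :
    H ◁ mu H ≫ contractLeft d = (α_ H H H).inv ≫ contractLeft d ▷ H ≫ mu H := by
  have e1 : (α_ H H H).inv ≫ mu H ▷ H ≫ counitMul H = H ◁ mu H ≫ counitMul H := by
    rw [h.assoc_counit]; simp
  calc H ◁ mu H ≫ contractLeft d
      = H ◁ (mu H ≫ d) ≫ (α_ H H H).inv ≫ counitMul H ▷ H ≫ (λ_ H).hom := by
        simp [contractLeft, rightExt]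
    _ = H ◁ (d ▷ H ≫ (H ⊗ H) ◁ d ≫ middle t) ⊗≫ (H ◁ mu H) ▷ (H ⊗ H) ⊗≫
          ((H ⊗ H) ◁ mu H ≫ counitMul H ▷ H) ⊗≫ 𝟙 _ := by
        rw [h.mul_comul]; monoidal
    _ = H ◁ (d ▷ H ≫ (H ⊗ H) ◁ d ≫ middle t) ⊗≫ (H ◁ mu H ≫ counitMul H) ▷ (H ⊗ H) ⊗≫
          mu H ⊗≫ 𝟙 _ := by
        rw [whisker_exchange]; monoidal
    _ = H ◁ (d ▷ H ≫ (H ⊗ H) ◁ d) ⊗≫ (H ⊗ H) ◁ (t ▷ H) ⊗≫ H ◁ d ▷ (H ⊗ H ⊗ H) ⊗≫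
          counitMul H ▷ (H ⊗ H ⊗ H ⊗ H) ⊗≫ counitMul H ▷ (H ⊗ H) ⊗≫
          mu H ⊗≫ 𝟙 _ := by
        rw [← e1, h.mul_mul_counit]; simp only [middle, rightExt]; monoidal
    _ = H ◁ (d ▷ H ⊗≫ H ◁ (H ◁ d ⊗≫ t ▷ H) ⊗≫ d ▷ (H ⊗ H ⊗ H)) ⊗≫
          counitMul H ▷ (H ⊗ H ⊗ H ⊗ H) ⊗≫ counitMul H ▷ (H ⊗ H) ⊗≫
          mu H ⊗≫ 𝟙 _ := by monoidal
    _ = H ◁ (d ▷ H ⊗≫ (H ◁ (H ◁ d ⊗≫ t ▷ H ⊗≫ 𝟙 (H ⊗ H ⊗ H)) ≫ d ▷ (H ⊗ H ⊗ H))) ⊗≫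
          counitMul H ▷ (H ⊗ H ⊗ H ⊗ H) ⊗≫ counitMul H ▷ (H ⊗ H) ⊗≫
          mu H ⊗≫ 𝟙 _ := by monoidal
    _ = H ◁ (d ≫ d ▷ H ≫ (α_ H H H).hom) ▷ H ⊗≫
          ((H ⊗ H) ◁ (H ◁ H ◁ d ⊗≫ H ◁ t ▷ H ⊗≫ 𝟙 (H ⊗ H ⊗ H ⊗ H)) ≫
          counitMul H ▷ (H ⊗ H ⊗ H ⊗ H)) ⊗≫ counitMul H ▷ (H ⊗ H) ⊗≫
          mu H ⊗≫ 𝟙 _ := by rw [whisker_exchange]; monoidal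
    _ = H ◁ d ▷ H ⊗≫ counitMul H ▷ (H ⊗ H) ⊗≫ (d ▷ H ≫ (H ⊗ H) ◁ d ≫ middle t ≫
          counitMul H ▷ (H ⊗ H) ≫ (λ_ _).hom ≫ mu H) := by
        rw [h.coassoc, whisker_exchange]
        calc _ = H ◁ d ▷ H ⊗≫ ((H ⊗ H) ◁ d ≫ counitMul H ▷ (H ⊗ H)) ▷ H ⊗≫
              H ◁ H ◁ d ⊗≫ middle t ⊗≫ counitMul H ▷ (H ⊗ H) ≫ (λ_ _).hom ≫ mu H := by
                simp only [middle]; monoidal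
          _ = _ := by rw [whisker_exchange]; monoidal
    _ = _ := by
        rw [← h.mul_eq_left]; simp only [contractLeft, rightExt]; monoidal

lemma mul_contractRight (h : IsWeakCoproduct H d t) :
    mu H ▷ H ≫ contractRight d = (α_ H H H).hom ≫ H ◁ contractRight d ≫ mu H := by
  have e1 : mu H ▷ H ≫ counitMul H =
      (α_ H H H).hom ≫ H ◁ leftExt d (counitMul H) ≫ H ◁ (ρ_ H).hom ≫ counitMul H := by
    calc mu H ▷ H ≫ counitMul H
        = (α_ H H H).hom ≫ H ◁ d ▷ H ⊗≫ (counitMul H ▷ (H ⊗ H) ≫ 𝟙_ C ◁ counitMul H) ⊗≫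
            𝟙 (𝟙_ C) := by
          rw [h.mul_mul_counit]; simp only [rightExt]; monoidal
      _ = _ := by rw [← whisker_exchange]; simp only [leftExt]; monoidal
  have e2 : d ▷ H ≫ (H ⊗ H) ◁ d = H ◁ d ≫ d ▷ (H ⊗ H) := (whisker_exchange _ _).symm
  have e3 : mu H ▷ (H ⊗ H) ≫ H ◁ mu H = (H ⊗ H) ◁ mu H ≫ mu H ▷ H :=
    (whisker_exchange _ _).symm
  calc mu H ▷ H ≫ contractRight d
      = (mu H ≫ d) ▷ H ≫ (α_ H H H).hom ≫ H ◁ counitMul H ≫ (ρ_ H).hom := by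
        simp [contractRight, leftExt]
    _ = (H ◁ d ≫ d ▷ (H ⊗ H) ≫ middle t) ▷ H ⊗≫ (H ⊗ H) ◁ (mu H ▷ H) ⊗≫
          (mu H ▷ (H ⊗ H) ≫ H ◁ counitMul H) ⊗≫ 𝟙 _ := by
        rw [h.mul_comul, e3, reassoc_of% e2]; monoidal
    _ = (H ◁ d ≫ d ▷ (H ⊗ H) ≫ middle t) ▷ H ⊗≫ (H ⊗ H) ◁ (mu H ▷ H ≫ counitMul H) ⊗≫
          mu H ⊗≫ 𝟙 _ := by
        rw [← whisker_exchange]; monoidal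
    _ = (H ◁ d ⊗≫ (d ▷ H ⊗≫ H ◁ t ⊗≫ 𝟙 (H ⊗ H ⊗ H)) ▷ H ≫ (H ⊗ H ⊗ H) ◁ d) ▷ H ⊗≫
          (H ⊗ H ⊗ H ⊗ H) ◁ counitMul H ⊗≫ (H ⊗ H) ◁ counitMul H ⊗≫
          mu H ⊗≫ 𝟙 _ := by
        rw [e1]; simp only [middle, leftExt]; monoidal
    _ = (H ◁ (d ≫ H ◁ d)) ▷ H ⊗≫
          ((d ▷ H ⊗≫ H ◁ t ⊗≫ 𝟙 (H ⊗ H ⊗ H)) ▷ (H ⊗ H ⊗ H) ≫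
          (H ⊗ H ⊗ H) ◁ (H ◁ counitMul H)) ⊗≫ (H ⊗ H) ◁ counitMul H ⊗≫
          mu H ⊗≫ 𝟙 _ := by rw [← whisker_exchange]; monoidal
    _ = (α_ H H H).hom ≫ H ◁ d ▷ H ⊗≫ (H ⊗ H) ◁ counitMul H ⊗≫ (H ◁ d ≫ d ▷ (H ⊗ H) ≫ middle t ≫
          (H ⊗ H) ◁ counitMul H ≫ (ρ_ _).hom ≫ mu H) := by
        rw [← h.coassoc, ← whisker_exchange]
        calc _ = (α_ H H H).hom ≫ H ◁ d ▷ H ⊗≫ H ◁ (d ▷ (H ⊗ H) ≫ (H ⊗ H) ◁ counitMul H) ⊗≫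
              d ▷ (H ⊗ H) ⊗≫ middle t ⊗≫ (H ⊗ H) ◁ counitMul H ≫ (ρ_ _).hom ≫ mu H := by
                simp only [middle]; monoidal
          _ = _ := by rw [← whisker_exchange]; monoidal
    _ = _ := by
        rw [← reassoc_of% e2, ← h.mul_eq_right]; simp only [contractRight, leftExt]; monoidal

/-- `hs` trades the exchange `t` inside the contraction for `s` on the coproduct of the first
factor; what results is exactly `mul_eq_left`. -/
lemma rightExt_contractRight (h : IsWeakCoproduct H d t) {s : H ⊗ H ⟶ H ⊗ H}
    (hs : H ◁ t ≫ (α_ H H H).inv ≫ counitMul H ▷ H ≫ (λ_ H).hom =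
      (α_ H H H).inv ≫ s ▷ H ≫ (α_ H H H).hom ≫ H ◁ counitMul H ≫ (ρ_ H).hom) :
    rightExt d (contractRight (d ≫ s)) ≫ mu H = mu H := by
  calc rightExt d (contractRight (d ≫ s)) ≫ mu H
      = H ◁ d ⊗≫ (d ▷ H ⊗≫ ((α_ H H H).inv ≫ s ▷ H ≫ (α_ H H H).hom ≫ H ◁ counitMul H ≫
          (ρ_ H).hom)) ▷ H ≫ mu H := by
        simp only [rightExt, contractRight, leftExt]; monoidal
    _ = (H ◁ d ≫ d ▷ (H ⊗ H)) ⊗≫ H ◁ t ▷ H ⊗≫ counitMul H ▷ (H ⊗ H) ⊗≫ mu H := by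
        rw [← hs]; monoidal
    _ = mu H := by
        rw [whisker_exchange]
        conv_rhs => rw [h.mul_eq_left]
        simp only [middle]; monoidal

end IsWeakCoproduct

/-- Through `leftExt_contractLeft` the composite becomes one of left extensions, so only its `ε ∘ μ`
component matters, and `h` settles that. -/
lemma rightExt_contractRight_idem {d d' : H ⟶ H ⊗ H}
    (hd : d' ≫ d' ▷ H ≫ (α_ H H H).hom = d' ≫ H ◁ d')
    (h : rightExt d (contractRight d') ≫ mu H = mu H) :
    rightExt d (contractRight d') ≫ contractRight d' = contractRight d' := by
  have h' : leftExt d' (contractLeft d) ≫ counitMul H = counitMul H := by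
    rw [leftExt_contractLeft, ← Category.assoc, h]
  calc rightExt d (contractRight d') ≫ contractRight d'
      = (leftExt d' (contractLeft d) ≫ leftExt d' (counitMul H)) ≫ (ρ_ H).hom := by
        rw [leftExt_contractLeft, contractRight, Category.assoc]
    _ = _ := by rw [leftExt_comp_leftExt d' hd, h', contractRight]

lemma leftExt_contractLeft_idem {d d' : H ⟶ H ⊗ H}
    (hd : d' ≫ d' ▷ H ≫ (α_ H H H).hom = d' ≫ H ◁ d')
    (h : leftExt d (contractLeft d') ≫ mu H = mu H) :
    leftExt d (contractLeft d') ≫ contractLeft d' = contractLeft d' := by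
  have h' : rightExt d' (contractRight d) ≫ counitMul H = counitMul H := by
    rw [← leftExt_contractLeft, ← Category.assoc, h]
  calc leftExt d (contractLeft d') ≫ contractLeft d'
      = (rightExt d' (contractRight d) ≫ rightExt d' (counitMul H)) ≫ (λ_ H).hom := by
        rw [leftExt_contractLeft, contractLeft, Category.assoc]
    _ = _ := by rw [rightExt_comp_rightExt d' hd, h', contractLeft]

end Coproduct

/-! ### The coopposite coproduct and formulas for the projections -/

section BraidedPart

variable {C : Type u} [Category.{v} C] [MonoidalCategory C] [BraidedCategory C] {H : C}

/-- Naturality slides the unit-valued `e` across the strand; the hexagon splits the resulting double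
crossing, and one crossing cancels. -/
lemma whiskerLeft_braiding_contract (e : H ⊗ H ⟶ 𝟙_ C) :
    H ◁ (β_ H H).hom ≫ (α_ H H H).inv ≫ e ▷ H ≫ (λ_ H).hom =
      (α_ H H H).inv ≫ (β_ H H).inv ▷ H ≫ (α_ H H H).hom ≫ H ◁ e ≫ (ρ_ H).hom := by
  have h : (β_ H (H ⊗ H)).hom ≫ e ▷ H ≫ (λ_ H).hom = H ◁ e ≫ (ρ_ H).hom := by
    rw [← BraidedCategory.braiding_naturality_right_assoc, braiding_leftUnitor]
  rw [← h, BraidedCategory.braiding_tensor_right_hom]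
  simp [← comp_whiskerRight_assoc]

lemma whiskerLeft_braiding_inv_contract (e : H ⊗ H ⟶ 𝟙_ C) :
    H ◁ (β_ H H).inv ≫ (α_ H H H).inv ≫ e ▷ H ≫ (λ_ H).hom =
      (α_ H H H).inv ≫ (β_ H H).hom ▷ H ≫ (α_ H H H).hom ≫ H ◁ e ≫ (ρ_ H).hom := by
  have h : (β_ (H ⊗ H) H).inv ≫ e ▷ H ≫ (λ_ H).hom = H ◁ e ≫ (ρ_ H).hom := by
    rw [← BraidedCategory.braiding_inv_naturality_right_assoc]
    simp
  rw [← h, BraidedCategory.braiding_tensor_left_inv]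
  simp [← comp_whiskerRight_assoc]

lemma braiding_inv_comul_coassoc (d : H ⟶ H ⊗ H)
    (hd : d ≫ d ▷ H ≫ (α_ H H H).hom = d ≫ H ◁ d) :
    (d ≫ (β_ H H).inv) ≫ (d ≫ (β_ H H).inv) ▷ H ≫ (α_ H H H).hom =
      (d ≫ (β_ H H).inv) ≫ H ◁ (d ≫ (β_ H H).inv) := by
  have h1 : (β_ H H).inv ≫ d ▷ H = H ◁ d ≫ (β_ (H ⊗ H) H).inv := by
    rw [BraidedCategory.braiding_inv_naturality_right]
  have h2 : (β_ H H).inv ≫ H ◁ d = d ▷ H ≫ (β_ H (H ⊗ H)).inv := by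
    rw [BraidedCategory.braiding_inv_naturality_left]
  have h3 := congrArg Iso.inv (BraidedCategory.yang_baxter_iso H H H)
  simp only [Iso.trans_inv, whiskerRightIso_inv, whiskerLeftIso_inv, Iso.symm_inv,
    Category.assoc] at h3
  simp only [comp_whiskerRight, whiskerLeft_comp, Category.assoc, reassoc_of% h1, reassoc_of% h2,
    BraidedCategory.braiding_tensor_left_inv, BraidedCategory.braiding_tensor_right_inv]
  rw [← reassoc_of% hd]
  rw [Iso.hom_inv_id_assoc, ← h3, Iso.hom_inv_id_assoc]

lemma middle_braiding (H : C) : middle (β_ H H).hom = tensorμ H H H H := by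
  simp [middle, tensorμ]

lemma middle_braiding_comp_braiding_inv (H : C) :
    middle (β_ H H).hom ≫ (β_ (H ⊗ H) (H ⊗ H)).inv =
      ((β_ H H).inv ⊗ₘ (β_ H H).inv) ≫ middle (β_ H H).inv := by
  calc _ = 𝟙 _ ⊗≫ H ◁ ((β_ H H).hom ≫ (β_ H H).inv) ▷ H ⊗≫ ((H ⊗ H) ◁ (β_ H H).inv ≫
        (β_ H H).inv ▷ (H ⊗ H)) ⊗≫ H ◁ (β_ H H).inv ▷ H ⊗≫ 𝟙 _ := by
        simp only [middle, BraidedCategory.braiding_tensor_left_inv,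
          BraidedCategory.braiding_tensor_right_inv]
        monoidal
    _ = _ := by
        rw [Iso.hom_inv_id, whisker_exchange]
        simp only [middle, MonoidalCategory.tensorHom_def]
        monoidal

variable [UnitalMagmaObj H] [ComonObj H]

lemma AxiomsA123.isWeakCoproduct (h : AxiomsA123 H) : IsWeakCoproduct H Δ[H] (β_ H H).hom where
  counit_left := by simp
  counit_right := by simp
  coassoc := by simp
  mul_comul := by
    simp only [h.a1, middle_braiding, MonoidalCategory.tensorHom_def, Category.assoc]
  mul_mul_counit := by
    rw [h.a2_comul, rightExt, MonoidalCategory.tensorHom_def]; monoidal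
  assoc_counit := h.a2_assoc

/-- The coopposite `c⁻¹ ∘ δ` with exchange `c⁻¹` has the same structure, the second half of (a2)
being its counit condition. Results on weak coproducts thus apply twice: `Π^L` and `Π^R` are
contractions for this coproduct. -/
lemma AxiomsA123.isWeakCoproduct_braiding_inv (h : AxiomsA123 H) :
    IsWeakCoproduct H (Δ[H] ≫ (β_ H H).inv) (β_ H H).inv where
  counit_left := by
    rw [Category.assoc, ← BraidedCategory.braiding_inv_naturality_right]; simp
  counit_right := by
    rw [Category.assoc, ← BraidedCategory.braiding_inv_naturality_left]; simp
  coassoc := braiding_inv_comul_coassoc _ (by simp)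
  mul_comul := by
    rw [← Category.assoc, h.isWeakCoproduct.mul_comul]
    have e : mu H ▷ (H ⊗ H) ≫ H ◁ mu H ≫ (β_ H H).inv =
        (β_ (H ⊗ H) (H ⊗ H)).inv ≫ mu H ▷ (H ⊗ H) ≫ H ◁ mu H := by
      rw [BraidedCategory.braiding_inv_naturality_right,
        BraidedCategory.braiding_inv_naturality_left_assoc, whisker_exchange]
    simp only [Category.assoc]
    rw [e, reassoc_of% middle_braiding_comp_braiding_inv H]
    calc _ = Δ[H] ▷ H ≫ ((H ⊗ H) ◁ Δ[H] ≫ (β_ H H).inv ▷ (H ⊗ H)) ≫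
          (H ⊗ H) ◁ (β_ H H).inv ≫ middle (β_ H H).inv ≫ mu H ▷ (H ⊗ H) ≫ H ◁ mu H := by
          simp only [MonoidalCategory.tensorHom_def, Category.assoc]
      _ = _ := by
          rw [whisker_exchange]
          simp only [comp_whiskerRight, whiskerLeft_comp, Category.assoc]
  mul_mul_counit := by
    rw [h.a2_braid, rightExt, MonoidalCategory.tensorHom_def]; monoidal
  assoc_counit := h.a2_assoc

lemma piL_eq_contractRight (H : C) [UnitalMagmaObj H] [ComonObj H] :
    piL H = (λ_ H).inv ≫ eta H ▷ H ≫ contractRight (Δ[H] ≫ (β_ H H).inv) := by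
  have := whiskerLeft_braiding_contract (counitMul H)
  simp only [piL, contractRight, leftExt]
  simp at this ⊢
  simp [this]

lemma piR_eq_contractLeft (H : C) [UnitalMagmaObj H] [ComonObj H] :
    piR H = (ρ_ H).inv ≫ H ◁ eta H ≫ contractLeft (Δ[H] ≫ (β_ H H).inv) := by
  have := whiskerLeft_braiding_inv_contract (counitMul H)
  simp only [piR, contractLeft, rightExt]
  simp at this ⊢
  simp [this]

lemma piL_eq (H : C) [UnitalMagmaObj H] [ComonObj H] :
    piL H = (ρ_ H).inv ≫ H ◁ (eta H ≫ Δ[H]) ≫ (α_ H H H).inv ≫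
      ((β_ H H).inv ≫ counitMul H) ▷ H ≫ (λ_ H).hom := by
  have h : (λ_ H).inv ≫ (eta H ≫ Δ[H]) ▷ H ≫ (β_ (H ⊗ H) H).hom =
      (ρ_ H).inv ≫ H ◁ (eta H ≫ Δ[H]) := by
    rw [BraidedCategory.braiding_naturality_left, leftUnitor_inv_braiding_assoc]
  rw [← reassoc_of% h, BraidedCategory.braiding_tensor_left_hom]
  simp only [piL, Category.assoc, comp_whiskerRight, Iso.hom_inv_id_assoc,
    hom_inv_whiskerRight_assoc]

lemma piR_eq (H : C) [UnitalMagmaObj H] [ComonObj H] :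
    piR H = (λ_ H).inv ≫ (eta H ≫ Δ[H]) ▷ H ≫ (α_ H H H).hom ≫
      H ◁ ((β_ H H).inv ≫ counitMul H) ≫ (ρ_ H).hom := by
  have h : (ρ_ H).inv ≫ H ◁ (eta H ≫ Δ[H]) ≫ (β_ H (H ⊗ H)).hom =
      (λ_ H).inv ≫ (eta H ≫ Δ[H]) ▷ H := by
    rw [BraidedCategory.braiding_naturality_right, rightUnitor_inv_braiding_assoc]
  rw [← reassoc_of% h, BraidedCategory.braiding_tensor_right_hom]
  simp only [piR, Category.assoc, whiskerLeft_comp, Iso.inv_hom_id_assoc,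
    whiskerLeft_hom_inv_assoc]

/-- Apply `ε` to the middle leg of `a3_mul`. -/
lemma AxiomsA123.comul_one (h : AxiomsA123 H) :
    eta H ≫ Δ[H] = (λ_ (𝟙_ C)).inv ≫ (eta H ≫ Δ[H]) ▷ 𝟙_ C ≫ (H ⊗ H) ◁ (eta H ≫ Δ[H]) ≫
      (α_ (H ⊗ H) H H).inv ≫ (α_ H H H).hom ▷ H ≫ (H ◁ counitMul H) ▷ H ≫ (ρ_ H).hom ▷ H := by
  calc eta H ≫ Δ[H] = (eta H ≫ Δ[H] ≫ Δ[H] ▷ H) ≫ (H ◁ ε[H]) ▷ H ≫ (ρ_ H).hom ▷ H := by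
        have : Δ[H] ≫ Δ[H] ▷ H ≫ (H ◁ ε[H]) ▷ H ≫ (ρ_ H).hom ▷ H = Δ[H] := by
          simp only [← comp_whiskerRight, ComonObj.comul_counit_assoc, Iso.inv_hom_id,
            id_whiskerRight, Category.comp_id]
        simp only [Category.assoc, this]
    _ = _ := by
        rw [h.a3_mul]
        simp only [MonoidalCategory.tensorHom_def, Category.assoc, comp_whiskerRight,
          whiskerLeft_comp]

end BraidedPart

/-! ### Split idempotents and relative inverses -/

section Split

variable {C : Type u} [Category.{v} C]

lemma nonempty_splitting [Limits.HasEqualizers C] {X : C} (e : X ⟶ X)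
    (he : e ≫ e = e) : Nonempty (Splitting e) := by
  have : IsIdempotentComplete C :=
    Idempotents.isIdempotentComplete_iff_hasEqualizer_of_id_and_idempotent C |>.2
      fun _ _ _ => inferInstance
  obtain ⟨Y, i, p, h1, h2⟩ := IsIdempotentComplete.idempotents_split X e he
  exact ⟨⟨Y, p, i, h2, h1⟩⟩

variable {X Y : C} {e : X ⟶ X} {e' : Y ⟶ Y} {B : X ⟶ Y} {φ : Y ⟶ X}

/-- `φ` is inverse to `B` relative to the idempotents `e` and `e'`. -/
structure IsRelativeInverse (e : X ⟶ X) (e' : Y ⟶ Y) (B : X ⟶ Y) (φ : Y ⟶ X) : Prop where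
  hom_inv : B ≫ φ = e
  inv_hom : φ ≫ B = e'
  inv_idem : φ ≫ e = φ
  idem_inv : e' ≫ φ = φ

lemma Splitting.j_comp_q (S : Splitting e) : S.j ≫ e ≫ S.q = 𝟙 S.obj := by
  calc S.j ≫ e ≫ S.q = S.j ≫ (S.q ≫ S.j) ≫ S.q := by rw [S.q_j]
    _ = 𝟙 S.obj := by rw [Category.assoc, reassoc_of% S.j_q, S.j_q]

lemma Splitting.j_comp (S : Splitting e) : S.j ≫ e = S.j := by
  calc S.j ≫ e = S.j ≫ S.q ≫ S.j := by rw [S.q_j]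
    _ = S.j := by rw [reassoc_of% S.j_q]

lemma Splitting.comp_q (S : Splitting e) : e ≫ S.q = S.q := by
  calc e ≫ S.q = (S.q ≫ S.j) ≫ S.q := by rw [S.q_j]
    _ = S.q := by rw [Category.assoc, S.j_q, Category.comp_id]

variable (L : Splitting e) (R : Splitting e')

lemma IsRelativeInverse.isIso_and_eq (hφ : IsRelativeInverse e e' B φ) :
    ∃ _ : IsIso (L.j ≫ B ≫ R.q), R.q ≫ inv (L.j ≫ B ≫ R.q) ≫ L.j = φ := by
  have h1 : (L.j ≫ B ≫ R.q) ≫ R.j ≫ φ ≫ L.q = 𝟙 _ := by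
    calc _ = L.j ≫ B ≫ (R.q ≫ R.j) ≫ φ ≫ L.q := by simp only [Category.assoc]
      _ = 𝟙 _ := by
        rw [R.q_j, reassoc_of% hφ.idem_inv, reassoc_of% hφ.hom_inv, L.j_comp_q]
  have h2 : (R.j ≫ φ ≫ L.q) ≫ L.j ≫ B ≫ R.q = 𝟙 _ := by
    calc _ = R.j ≫ φ ≫ (L.q ≫ L.j) ≫ B ≫ R.q := by simp only [Category.assoc]
      _ = 𝟙 _ := by
        rw [L.q_j, reassoc_of% hφ.inv_idem, reassoc_of% hφ.inv_hom, R.j_comp_q]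
  have hi : IsIso (L.j ≫ B ≫ R.q) := ⟨_, h1, h2⟩
  refine ⟨hi, ?_⟩
  rw [IsIso.inv_eq_of_hom_inv_id h1]
  calc _ = (R.q ≫ R.j) ≫ φ ≫ L.q ≫ L.j := by simp only [Category.assoc]
    _ = φ := by rw [R.q_j, L.q_j, hφ.inv_idem, hφ.idem_inv]

/-- The absorption hypotheses let `B` factor as `q`, then the middle isomorphism, then `j`, so that
inverting the middle inverts `B` relatively. -/
lemma isRelativeInverse_of_isIso (h1 : e ≫ B = B) (h2 : B ≫ e' = B)
    [hi : IsIso (L.j ≫ B ≫ R.q)] :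
    IsRelativeInverse e e' B (R.q ≫ inv (L.j ≫ B ≫ R.q) ≫ L.j) := by
  have aux (f : L.obj ⟶ R.obj) [IsIso f] (hf : B = L.q ≫ f ≫ R.j) :
      IsRelativeInverse e e' B (R.q ≫ inv f ≫ L.j) := by
    constructor
    · rw [hf]; simp only [Category.assoc, reassoc_of% R.j_q, IsIso.hom_inv_id_assoc, L.q_j]
    · rw [hf]; simp only [Category.assoc, reassoc_of% L.j_q, IsIso.inv_hom_id_assoc, R.q_j]
    · simp only [Category.assoc, L.j_comp]
    · simp only [← Category.assoc, R.comp_q]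
  apply aux
  calc B = e ≫ B ≫ e' := by rw [h2, h1]
    _ = (L.q ≫ L.j) ≫ B ≫ R.q ≫ R.j := by rw [L.q_j, R.q_j]
    _ = _ := by simp only [Category.assoc]

end Split

/-! ### Colinearity of relative inverses -/

section Colinear

variable {C : Type u} [Category.{v} C] [MonoidalCategory C] {H : C} [ComonObj H]

lemma rightExt_comp_counit {X : C} (a : H ⊗ H ⟶ X) :
    rightExt Δ[H] a ≫ X ◁ ε[H] ≫ (ρ_ X).hom = a := by
  calc _ = H ◁ Δ[H] ≫ (α_ H H H).inv ≫ (a ▷ H ≫ X ◁ ε[H]) ≫ (ρ_ X).hom := by simp [rightExt]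
    _ = H ◁ (Δ[H] ≫ H ◁ ε[H]) ⊗≫ a := by rw [← whisker_exchange]; monoidal
    _ = _ := by rw [ComonObj.comul_counit]; monoidal

lemma leftExt_comp_counit {X : C} (a : H ⊗ H ⟶ X) :
    leftExt Δ[H] a ≫ ε[H] ▷ X ≫ (λ_ X).hom = a := by
  calc _ = Δ[H] ▷ H ≫ (α_ H H H).hom ≫ (H ◁ a ≫ ε[H] ▷ X) ≫ (λ_ X).hom := by simp [leftExt]
    _ = (Δ[H] ≫ ε[H] ▷ H) ▷ H ⊗≫ a := by rw [whisker_exchange]; monoidal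
    _ = _ := by rw [ComonObj.counit_comul]; monoidal

lemma rightExt_injective {X : C} {a b : H ⊗ H ⟶ X} (h : rightExt Δ[H] a = rightExt Δ[H] b) :
    a = b := by
  rw [← rightExt_comp_counit a, h, rightExt_comp_counit]

lemma leftExt_injective {X : C} {a b : H ⊗ H ⟶ X} (h : leftExt Δ[H] a = leftExt Δ[H] b) :
    a = b := by
  rw [← leftExt_comp_counit a, h, leftExt_comp_counit]

/-- An inverse of a colinear map is colinear, even relative to colinear idempotents; a colinear map
is the extension of its counit component. -/
lemma eq_rightExt_of_isRelativeInverse {a b c : H ⊗ H ⟶ H} {φ : H ⊗ H ⟶ H ⊗ H}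
    (hφ : IsRelativeInverse (rightExt Δ[H] a) (rightExt Δ[H] b) (rightExt Δ[H] c) φ) :
    φ = rightExt Δ[H] (φ ≫ H ◁ ε[H] ≫ (ρ_ H).hom) := by
  have hK (x : H ⊗ H ⟶ H) : (H ◁ Δ[H] ≫ (α_ H H H).inv) ≫ rightExt Δ[H] x ▷ H =
      rightExt Δ[H] x ≫ H ◁ Δ[H] ≫ (α_ H H H).inv := by
    rw [reassoc_of% whiskerLeft_comp_rightExt Δ[H] (by simp) x]; simp [rightExt]
  have key : (H ◁ Δ[H] ≫ (α_ H H H).inv) ≫ φ ▷ H = φ ≫ H ◁ Δ[H] ≫ (α_ H H H).inv := by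
    -- From here only the commutation of the coaction `K` with extensions is needed.
    generalize H ◁ Δ[H] ≫ (α_ H H H).inv = K at *
    calc K ≫ φ ▷ H = (K ≫ rightExt Δ[H] b ▷ H) ≫ φ ▷ H := by
          rw [Category.assoc, ← comp_whiskerRight, hφ.idem_inv]
      _ = (φ ≫ rightExt Δ[H] c ≫ K) ≫ φ ▷ H := by
          rw [hK, ← reassoc_of% hφ.inv_hom]
      _ = φ ≫ rightExt Δ[H] a ≫ K := by
          rw [← hK, ← hK, Category.assoc, Category.assoc, ← comp_whiskerRight, hφ.hom_inv]
      _ = φ ≫ K := by rw [reassoc_of% hφ.inv_idem]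
  calc φ = φ ≫ H ◁ (Δ[H] ≫ ε[H] ▷ H ≫ (λ_ H).hom) := by simp
    _ = (φ ≫ H ◁ Δ[H] ≫ (α_ H H H).inv) ≫ (H ◁ ε[H] ≫ (ρ_ H).hom) ▷ H := by monoidal
    _ = rightExt Δ[H] φ ≫ (H ◁ ε[H] ≫ (ρ_ H).hom) ▷ H := by
        rw [← key, rightExt]; simp only [Category.assoc]
    _ = _ := rightExt_comp_whiskerRight _ _ _

lemma eq_leftExt_of_isRelativeInverse {a b c : H ⊗ H ⟶ H} {φ : H ⊗ H ⟶ H ⊗ H}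
    (hφ : IsRelativeInverse (leftExt Δ[H] a) (leftExt Δ[H] b) (leftExt Δ[H] c) φ) :
    φ = leftExt Δ[H] (φ ≫ ε[H] ▷ H ≫ (λ_ H).hom) := by
  have hK (x : H ⊗ H ⟶ H) : (Δ[H] ▷ H ≫ (α_ H H H).hom) ≫ H ◁ leftExt Δ[H] x =
      leftExt Δ[H] x ≫ Δ[H] ▷ H ≫ (α_ H H H).hom := by
    rw [reassoc_of% whiskerRight_comp_leftExt Δ[H] (by simp) x]; simp [leftExt]
  have key : (Δ[H] ▷ H ≫ (α_ H H H).hom) ≫ H ◁ φ = φ ≫ Δ[H] ▷ H ≫ (α_ H H H).hom := by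
    generalize Δ[H] ▷ H ≫ (α_ H H H).hom = K at *
    calc K ≫ H ◁ φ = (K ≫ H ◁ leftExt Δ[H] b) ≫ H ◁ φ := by
          rw [Category.assoc, ← whiskerLeft_comp, hφ.idem_inv]
      _ = (φ ≫ leftExt Δ[H] c ≫ K) ≫ H ◁ φ := by
          rw [hK, ← reassoc_of% hφ.inv_hom]
      _ = φ ≫ leftExt Δ[H] a ≫ K := by
          rw [← hK, ← hK, Category.assoc, Category.assoc, ← whiskerLeft_comp, hφ.hom_inv]
      _ = φ ≫ K := by rw [reassoc_of% hφ.inv_idem]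
  calc φ = φ ≫ (Δ[H] ≫ H ◁ ε[H] ≫ (ρ_ H).hom) ▷ H := by simp
    _ = (φ ≫ Δ[H] ▷ H ≫ (α_ H H H).hom) ≫ H ◁ (ε[H] ▷ H ≫ (λ_ H).hom) := by monoidal
    _ = leftExt Δ[H] φ ≫ H ◁ (ε[H] ▷ H ≫ (λ_ H).hom) := by
        rw [← key, leftExt]; simp only [Category.assoc]
    _ = _ := leftExt_comp_whiskerLeft _ _ _

lemma rightExt_rightExt {X : C} (a : H ⊗ H ⟶ H) (b : H ⊗ H ⟶ X) :
    rightExt Δ[H] a ≫ rightExt Δ[H] b = rightExt Δ[H] (rightExt Δ[H] a ≫ b) :=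
  rightExt_comp_rightExt _ (by simp) a b

lemma leftExt_leftExt {X : C} (a : H ⊗ H ⟶ H) (b : H ⊗ H ⟶ X) :
    leftExt Δ[H] a ≫ leftExt Δ[H] b = leftExt Δ[H] (leftExt Δ[H] a ≫ b) :=
  leftExt_comp_leftExt _ (by simp) a b

end Colinear

/-! ### Nuclear endomorphisms and convolution -/

section Nuclear

variable {C : Type u} [Category.{v} C] [MonoidalCategory C] (H : C) [UnitalMagmaObj H]

/-- `(x y) p(z) = x (y p(z))`. -/
def RightNuclear (p : H ⟶ H) : Prop :=
  mu H ▷ H ≫ H ◁ p ≫ mu H = (α_ H H H).hom ≫ H ◁ (H ◁ p ≫ mu H) ≫ mu H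

/-- `p(x) (y z) = (p(x) y) z`. -/
def LeftNuclear (p : H ⟶ H) : Prop :=
  H ◁ mu H ≫ p ▷ H ≫ mu H = (α_ H H H).inv ≫ (p ▷ H ≫ mu H) ▷ H ≫ mu H

lemma one_whiskerLeft_mul (p : H ⟶ H) : (λ_ H).inv ≫ eta H ▷ H ≫ H ◁ p ≫ mu H = p := by
  rw [← whisker_exchange_assoc, UnitalMagmaObj.one_mul]; simp

lemma one_whiskerRight_mul (p : H ⟶ H) : (ρ_ H).inv ≫ H ◁ eta H ≫ p ▷ H ≫ mu H = p := by
  rw [whisker_exchange_assoc, UnitalMagmaObj.mul_one]; simp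

variable [ComonObj H]

lemma omegaOne_eq (p : H ⟶ H) : omegaOne H p = rightExt Δ[H] (H ◁ p ≫ mu H) := by
  simp [omegaOne, rightExt]

lemma omegaTwo_eq (p : H ⟶ H) : omegaTwo H p = leftExt Δ[H] (p ▷ H ≫ mu H) := by
  simp [omegaTwo, leftExt]

lemma rightGalois_eq : rightGalois H = rightExt Δ[H] (H ◁ 𝟙 H ≫ mu H) := by
  simp [rightGalois, rightExt]

lemma leftGalois_eq : leftGalois H = leftExt Δ[H] (𝟙 H ▷ H ≫ mu H) := by
  simp [leftGalois, leftExt]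

/-- Evaluation at the unit turns composites of extensions into convolution products; this is how
antipode identities are extracted. -/
lemma one_rightExt (p q : H ⟶ H) :
    (λ_ H).inv ≫ eta H ▷ H ≫ rightExt Δ[H] (H ◁ p ≫ mu H) ≫ H ◁ q ≫ mu H = conv H p q := by
  calc _ = (λ_ H).inv ≫ (eta H ▷ H ≫ H ◁ (Δ[H] ≫ p ▷ H)) ⊗≫ mu H ▷ H ⊗≫ H ◁ q ≫ mu H := by
        simp only [rightExt]; monoidal
    _ = Δ[H] ≫ p ▷ H ⊗≫ (eta H ▷ H ≫ mu H) ▷ H ⊗≫ H ◁ q ≫ mu H := by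
        rw [← whisker_exchange]; monoidal
    _ = _ := by
        rw [UnitalMagmaObj.one_mul, conv, MonoidalCategory.tensorHom_def]; monoidal

lemma one_leftExt (p q : H ⟶ H) :
    (ρ_ H).inv ≫ H ◁ eta H ≫ leftExt Δ[H] (p ▷ H ≫ mu H) ≫ q ▷ H ≫ mu H = conv H q p := by
  calc _ = (ρ_ H).inv ≫ (H ◁ eta H ≫ (Δ[H] ≫ H ◁ p) ▷ H) ⊗≫ H ◁ mu H ⊗≫ q ▷ H ≫ mu H := by
        simp only [leftExt]; monoidal
    _ = Δ[H] ≫ H ◁ p ⊗≫ H ◁ (H ◁ eta H ≫ mu H) ⊗≫ q ▷ H ≫ mu H := by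
        rw [whisker_exchange]; monoidal
    _ = _ := by
        rw [UnitalMagmaObj.mul_one, conv, MonoidalCategory.tensorHom_def']; monoidal

variable {H}

lemma RightNuclear.rightExt_comp {q : H ⟶ H} (hq : RightNuclear H q) (p : H ⟶ H) :
    rightExt Δ[H] (H ◁ p ≫ mu H) ≫ H ◁ q ≫ mu H = H ◁ conv H p q ≫ mu H := by
  calc _ = H ◁ Δ[H] ≫ (α_ H H H).inv ≫ (H ◁ p) ▷ H ≫ mu H ▷ H ≫ H ◁ q ≫ mu H := by
        simp [rightExt]
    _ = _ := by rw [hq, conv, MonoidalCategory.tensorHom_def]; monoidal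

lemma LeftNuclear.leftExt_comp {q : H ⟶ H} (hq : LeftNuclear H q) (p : H ⟶ H) :
    leftExt Δ[H] (p ▷ H ≫ mu H) ≫ q ▷ H ≫ mu H = conv H q p ▷ H ≫ mu H := by
  calc _ = Δ[H] ▷ H ≫ (α_ H H H).hom ≫ H ◁ (p ▷ H) ≫ H ◁ mu H ≫ q ▷ H ≫ mu H := by
        simp [leftExt]
    _ = _ := by rw [hq, conv, MonoidalCategory.tensorHom_def']; monoidal

end Nuclear

/-! ### Maps determined by their value at the unit -/

section Linear

variable {C : Type u} [Category.{v} C] [MonoidalCategory C] {H : C} [UnitalMagmaObj H]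

/-- Write `x = x · 1` and pull `x` out with `mul_contractRight`. -/
lemma IsWeakCoproduct.contractRight_eq [ComonObj H] {d : H ⟶ H ⊗ H} {t : H ⊗ H ⟶ H ⊗ H}
    (h : IsWeakCoproduct H d t) :
    contractRight d = H ◁ ((λ_ H).inv ≫ eta H ▷ H ≫ contractRight d) ≫ mu H := by
  calc contractRight d = (ρ_ H).inv ▷ H ≫ (H ◁ eta H ≫ mu H) ▷ H ≫ contractRight d := by
        rw [UnitalMagmaObj.mul_one]; simp
    _ = (ρ_ H).inv ▷ H ≫ (H ◁ eta H) ▷ H ≫ mu H ▷ H ≫ contractRight d := by simp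
    _ = _ := by rw [h.mul_contractRight]; monoidal

lemma IsWeakCoproduct.contractLeft_eq [ComonObj H] {d : H ⟶ H ⊗ H} {t : H ⊗ H ⟶ H ⊗ H}
    (h : IsWeakCoproduct H d t) :
    contractLeft d = ((ρ_ H).inv ≫ H ◁ eta H ≫ contractLeft d) ▷ H ≫ mu H := by
  calc contractLeft d = H ◁ (λ_ H).inv ≫ H ◁ (eta H ▷ H ≫ mu H) ≫ contractLeft d := by
        rw [UnitalMagmaObj.one_mul]; simp
    _ = H ◁ (λ_ H).inv ≫ H ◁ eta H ▷ H ≫ H ◁ mu H ≫ contractLeft d := by simp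
    _ = _ := by rw [h.mul_contractLeft]; monoidal

lemma almostLeftLinear_rightExt [ComonObj H] (p : H ⟶ H) :
    AlmostLeftLinear H (rightExt Δ[H] (H ◁ p ≫ mu H)) := by
  rw [AlmostLeftLinear]
  symm
  calc _ = H ◁ ((λ_ H).inv ≫ (eta H ▷ H ≫ H ◁ (Δ[H] ≫ p ▷ H)) ⊗≫ mu H ▷ H) ⊗≫ mu H ▷ H := by
        simp only [rightExt]; monoidal
    _ = H ◁ (Δ[H] ≫ p ▷ H ⊗≫ (eta H ▷ H ≫ mu H) ▷ H) ⊗≫ mu H ▷ H := by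
        rw [← whisker_exchange]; monoidal
    _ = _ := by rw [UnitalMagmaObj.one_mul, rightExt]; monoidal

lemma almostRightLinear_leftExt [ComonObj H] (p : H ⟶ H) :
    AlmostRightLinear H (leftExt Δ[H] (p ▷ H ≫ mu H)) := by
  rw [AlmostRightLinear]
  symm
  calc _ = ((ρ_ H).inv ≫ (H ◁ eta H ≫ (Δ[H] ≫ H ◁ p) ▷ H) ⊗≫ H ◁ mu H) ▷ H ⊗≫ H ◁ mu H := by
        simp only [leftExt]; monoidal
    _ = (Δ[H] ≫ H ◁ p ⊗≫ H ◁ (H ◁ eta H ≫ mu H)) ▷ H ⊗≫ H ◁ mu H := by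
        rw [whisker_exchange]; monoidal
    _ = _ := by rw [UnitalMagmaObj.mul_one, leftExt]; monoidal

lemma AlmostLeftLinear.comp_whiskerLeft {φ : H ⊗ H ⟶ H ⊗ H} (h : AlmostLeftLinear H φ)
    (f : H ⟶ 𝟙_ C) :
    φ ≫ H ◁ f ≫ (ρ_ H).hom =
      H ◁ ((λ_ H).inv ≫ eta H ▷ H ≫ φ ≫ H ◁ f ≫ (ρ_ H).hom) ≫ mu H := by
  conv_lhs => rw [h]
  calc _ = H ◁ ((λ_ H).inv ≫ eta H ▷ H ≫ φ) ≫ (α_ H H H).inv ≫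
        (mu H ▷ H ≫ H ◁ f) ≫ (ρ_ H).hom := by simp
    _ = _ := by rw [← whisker_exchange]; monoidal

lemma AlmostRightLinear.comp_whiskerRight {φ : H ⊗ H ⟶ H ⊗ H} (h : AlmostRightLinear H φ)
    (f : H ⟶ 𝟙_ C) :
    φ ≫ f ▷ H ≫ (λ_ H).hom =
      ((ρ_ H).inv ≫ H ◁ eta H ≫ φ ≫ f ▷ H ≫ (λ_ H).hom) ▷ H ≫ mu H := by
  conv_lhs => rw [h]
  calc _ = ((ρ_ H).inv ≫ H ◁ eta H ≫ φ) ▷ H ≫ (α_ H H H).hom ≫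
        (H ◁ mu H ≫ f ▷ H) ≫ (λ_ H).hom := by simp
    _ = _ := by rw [whisker_exchange]; monoidal

end Linear

/-! ### Absorption between projections built from `δ ∘ η` -/

section Projections

variable {C : Type u} [Category.{v} C] [MonoidalCategory C] {H : C}

/-- With `w = w₁ ⊗ w₂` and a second copy `w'`, the composite sends `h` to `w₁ e(w₂, w'₁) e'(w'₂,
h)`, where `hw` contracts the two copies to one. -/
lemma whiskered_comp_of_eq_one (w : 𝟙_ C ⟶ H ⊗ H) (e e' : H ⊗ H ⟶ 𝟙_ C)
    (hw : w = (λ_ (𝟙_ C)).inv ≫ w ▷ 𝟙_ C ≫ (H ⊗ H) ◁ w ≫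
      (α_ (H ⊗ H) H H).inv ≫ (α_ H H H).hom ▷ H ≫ (H ◁ e) ▷ H ≫ (ρ_ H).hom ▷ H) :
    ((λ_ H).inv ≫ w ▷ H ≫ (α_ H H H).hom ≫ H ◁ e' ≫ (ρ_ H).hom) ≫
      ((λ_ H).inv ≫ w ▷ H ≫ (α_ H H H).hom ≫ H ◁ e ≫ (ρ_ H).hom) =
    (λ_ H).inv ≫ w ▷ H ≫ (α_ H H H).hom ≫ H ◁ e' ≫ (ρ_ H).hom := by
  symm
  calc _ = 𝟙 H ⊗≫ w ▷ H ⊗≫ (H ⊗ H) ◁ w ▷ H ⊗≫ H ◁ (e ▷ (H ⊗ H) ≫ 𝟙_ C ◁ e') ⊗≫ 𝟙 H := by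
        conv_lhs => rw [hw]
        monoidal
    _ = 𝟙 H ⊗≫ (w ▷ (𝟙_ C ⊗ H) ≫ (H ⊗ H) ◁ (w ▷ H ⊗≫ H ◁ e')) ⊗≫ H ◁ e ⊗≫ 𝟙 H := by
        rw [← whisker_exchange]; monoidal
    _ = _ := by rw [← whisker_exchange]; monoidal

lemma whiskered_comp_of_eq_one' (w : 𝟙_ C ⟶ H ⊗ H) (e e' : H ⊗ H ⟶ 𝟙_ C)
    (hw : w = (λ_ (𝟙_ C)).inv ≫ w ▷ 𝟙_ C ≫ (H ⊗ H) ◁ w ≫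
      (α_ (H ⊗ H) H H).inv ≫ (α_ H H H).hom ▷ H ≫ (H ◁ e) ▷ H ≫ (ρ_ H).hom ▷ H) :
    ((ρ_ H).inv ≫ H ◁ w ≫ (α_ H H H).inv ≫ e' ▷ H ≫ (λ_ H).hom) ≫
      ((ρ_ H).inv ≫ H ◁ w ≫ (α_ H H H).inv ≫ e ▷ H ≫ (λ_ H).hom) =
    (ρ_ H).inv ≫ H ◁ w ≫ (α_ H H H).inv ≫ e' ▷ H ≫ (λ_ H).hom := by
  symm
  calc _ = 𝟙 H ⊗≫ H ◁ w ⊗≫ (H ⊗ H) ◁ H ◁ w ⊗≫ ((H ⊗ H) ◁ e ≫ e' ▷ 𝟙_ C) ▷ H ⊗≫ 𝟙 H := by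
        conv_lhs => rw [hw]
        monoidal
    _ = 𝟙 H ⊗≫ H ◁ w ⊗≫ ((H ⊗ H) ◁ (𝟙 H ⊗≫ H ◁ w ⊗≫ 𝟙 (H ⊗ H ⊗ H)) ≫ e' ▷ (H ⊗ H ⊗ H)) ⊗≫
          e ▷ H ⊗≫ 𝟙 H := by
        rw [whisker_exchange]; monoidal
    _ = _ := by rw [whisker_exchange]; monoidal

end Projections

/-! ### Nuclearity, absorption, and the antipode correspondence -/

section Braided

variable {C : Type u} [Category.{v} C] [MonoidalCategory C] [BraidedCategory C] {H : C}
  [UnitalMagmaObj H] [ComonObj H]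

namespace AxiomsA123

lemma piR_comp (h : AxiomsA123 H) :
    piR H ≫ (λ_ H).inv ≫ eta H ▷ H ≫ contractRight Δ[H] = piR H := by
  have := whiskered_comp_of_eq_one _ _ ((β_ H H).inv ≫ counitMul H) h.comul_one
  rw [← piR_eq] at this
  simpa [contractRight, leftExt] using this

lemma piL_comp (h : AxiomsA123 H) :
    piL H ≫ (ρ_ H).inv ≫ H ◁ eta H ≫ contractLeft Δ[H] = piL H := by
  have := whiskered_comp_of_eq_one' _ _ ((β_ H H).inv ≫ counitMul H) h.comul_one
  rw [← piL_eq] at this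
  simpa [contractLeft, rightExt] using this

lemma whiskerLeft_piL_mul (h : AxiomsA123 H) :
    H ◁ piL H ≫ mu H = contractRight (Δ[H] ≫ (β_ H H).inv) := by
  rw [h.isWeakCoproduct_braiding_inv.contractRight_eq, ← piL_eq_contractRight]

lemma whiskerRight_piR_mul (h : AxiomsA123 H) :
    piR H ▷ H ≫ mu H = contractLeft (Δ[H] ≫ (β_ H H).inv) := by
  rw [h.isWeakCoproduct_braiding_inv.contractLeft_eq, ← piR_eq_contractLeft]

/-- `Π^R` is a contraction for `c⁻¹ ∘ δ` on the left only. Since its values are fixed by `h ↦ 1₁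
ε(1₂ h)`, right multiplication by them is also a contraction, now for `δ`. -/
lemma whiskerLeft_piR_mul (h : AxiomsA123 H) :
    H ◁ piR H ≫ mu H = H ◁ piR H ≫ contractRight Δ[H] := by
  conv_rhs => rw [h.isWeakCoproduct.contractRight_eq, ← whiskerLeft_comp_assoc, h.piR_comp]

lemma whiskerRight_piL_mul (h : AxiomsA123 H) :
    piL H ▷ H ≫ mu H = piL H ▷ H ≫ contractLeft Δ[H] := by
  conv_rhs => rw [h.isWeakCoproduct.contractLeft_eq, ← comp_whiskerRight_assoc, h.piL_comp]

lemma rightNuclear_piL (h : AxiomsA123 H) : RightNuclear H (piL H) := by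
  rw [RightNuclear, h.whiskerLeft_piL_mul, h.isWeakCoproduct_braiding_inv.mul_contractRight]

lemma leftNuclear_piR (h : AxiomsA123 H) : LeftNuclear H (piR H) := by
  rw [LeftNuclear, h.whiskerRight_piR_mul, h.isWeakCoproduct_braiding_inv.mul_contractLeft]

lemma rightNuclear_piR (h : AxiomsA123 H) : RightNuclear H (piR H) := by
  rw [RightNuclear, h.whiskerLeft_piR_mul, ← whisker_exchange_assoc,
    h.isWeakCoproduct.mul_contractRight]
  simp

lemma leftNuclear_piL (h : AxiomsA123 H) : LeftNuclear H (piL H) := by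
  rw [LeftNuclear, h.whiskerRight_piL_mul, whisker_exchange_assoc,
    h.isWeakCoproduct.mul_contractLeft]
  simp

lemma rightExt_piL_mul (h : AxiomsA123 H) :
    rightExt Δ[H] (H ◁ piL H ≫ mu H) ≫ mu H = mu H := by
  rw [h.whiskerLeft_piL_mul]
  exact h.isWeakCoproduct.rightExt_contractRight (whiskerLeft_braiding_contract (counitMul H))

lemma leftExt_piR_mul (h : AxiomsA123 H) :
    leftExt Δ[H] (piR H ▷ H ≫ mu H) ≫ mu H = mu H := by
  rw [h.whiskerRight_piR_mul, leftExt_contractLeft]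
  -- The choice `s = c` makes the inner coproduct `c⁻¹ ∘ δ` followed by `c`, that is `δ`.
  have := h.isWeakCoproduct_braiding_inv.rightExt_contractRight (s := (β_ H H).hom)
    (whiskerLeft_braiding_inv_contract (counitMul H))
  rwa [Category.assoc, Iso.inv_hom_id, Category.comp_id] at this

lemma rightExt_piL_piL (h : AxiomsA123 H) :
    rightExt Δ[H] (H ◁ piL H ≫ mu H) ≫ H ◁ piL H ≫ mu H = H ◁ piL H ≫ mu H := by
  have := h.rightExt_piL_mul
  rw [h.whiskerLeft_piL_mul] at this ⊢
  exact rightExt_contractRight_idem h.isWeakCoproduct_braiding_inv.coassoc this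

lemma leftExt_piR_piR (h : AxiomsA123 H) :
    leftExt Δ[H] (piR H ▷ H ≫ mu H) ≫ piR H ▷ H ≫ mu H = piR H ▷ H ≫ mu H := by
  have := h.leftExt_piR_mul
  rw [h.whiskerRight_piR_mul] at this ⊢
  exact leftExt_contractLeft_idem h.isWeakCoproduct_braiding_inv.coassoc this

lemma conv_piL_piL (h : AxiomsA123 H) : conv H (piL H) (piL H) = piL H := by
  rw [← one_rightExt, h.rightExt_piL_piL, one_whiskerLeft_mul]

lemma conv_piR_piR (h : AxiomsA123 H) : conv H (piR H) (piR H) = piR H := by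
  rw [← one_leftExt, h.leftExt_piR_piR, one_whiskerRight_mul]

lemma conv_piL_id (h : AxiomsA123 H) : conv H (piL H) (𝟙 H) = 𝟙 H := by
  rw [← one_rightExt, whiskerLeft_id, Category.id_comp, h.rightExt_piL_mul,
    UnitalMagmaObj.one_mul, Iso.inv_hom_id]

lemma conv_id_piR (h : AxiomsA123 H) : conv H (𝟙 H) (piR H) = 𝟙 H := by
  rw [← one_leftExt, id_whiskerRight, Category.id_comp, h.leftExt_piR_mul,
    UnitalMagmaObj.mul_one, Iso.inv_hom_id]

end AxiomsA123

namespace AxiomsA123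

lemma omegaL1_idem (h : AxiomsA123 H) : omegaL1 H ≫ omegaL1 H = omegaL1 H := by
  rw [omegaL1, omegaOne_eq, rightExt_rightExt, h.rightExt_piL_piL]

lemma omegaR1_idem (h : AxiomsA123 H) : omegaR1 H ≫ omegaR1 H = omegaR1 H := by
  rw [omegaR1, omegaOne_eq, rightExt_rightExt, h.rightNuclear_piR.rightExt_comp, h.conv_piR_piR]

lemma omegaL2_idem (h : AxiomsA123 H) : omegaL2 H ≫ omegaL2 H = omegaL2 H := by
  rw [omegaL2, omegaTwo_eq, leftExt_leftExt, h.leftNuclear_piL.leftExt_comp, h.conv_piL_piL]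

lemma omegaR2_idem (h : AxiomsA123 H) : omegaR2 H ≫ omegaR2 H = omegaR2 H := by
  rw [omegaR2, omegaTwo_eq, leftExt_leftExt, h.leftExt_piR_piR]

lemma omegaL1_rightGalois (h : AxiomsA123 H) : omegaL1 H ≫ rightGalois H = rightGalois H := by
  rw [omegaL1, omegaOne_eq, rightGalois_eq, rightExt_rightExt, whiskerLeft_id, Category.id_comp,
    h.rightExt_piL_mul]

lemma rightGalois_omegaR1 (h : AxiomsA123 H) : rightGalois H ≫ omegaR1 H = rightGalois H := by
  rw [omegaR1, omegaOne_eq, rightGalois_eq, rightExt_rightExt, h.rightNuclear_piR.rightExt_comp,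
    h.conv_id_piR]

lemma omegaR2_leftGalois (h : AxiomsA123 H) : omegaR2 H ≫ leftGalois H = leftGalois H := by
  rw [omegaR2, omegaTwo_eq, leftGalois_eq, leftExt_leftExt, id_whiskerRight, Category.id_comp,
    h.leftExt_piR_mul]

lemma leftGalois_omegaL2 (h : AxiomsA123 H) : leftGalois H ≫ omegaL2 H = leftGalois H := by
  rw [omegaL2, omegaTwo_eq, leftGalois_eq, leftExt_leftExt, h.leftNuclear_piL.leftExt_comp,
    h.conv_piL_id]

end AxiomsA123

/-- `s` satisfies the conditions on an antipode that involve the right Galois morphism. -/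
structure IsRightAntipode (s : H ⟶ H) : Prop where
  id_conv : piL H = conv H (𝟙 H) s
  conv_id : piR H = conv H s (𝟙 H)
  conv_piL : conv H s (piL H) = s
  piR_conv : conv H (piR H) s = s
  mul_mul : rightExt Δ[H] (mu H) ≫ H ◁ s ≫ mu H = H ◁ piL H ≫ mu H
  mul_mul' : rightExt Δ[H] (H ◁ s ≫ mu H) ≫ mu H = H ◁ piR H ≫ mu H

/-- `s` satisfies the conditions on an antipode that involve the left Galois morphism. -/
structure IsLeftAntipode (s : H ⟶ H) : Prop where
  id_conv : piL H = conv H (𝟙 H) s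
  conv_id : piR H = conv H s (𝟙 H)
  conv_piL : conv H s (piL H) = s
  piR_conv : conv H (piR H) s = s
  mul_mul : leftExt Δ[H] (mu H) ≫ s ▷ H ≫ mu H = piR H ▷ H ≫ mu H
  mul_mul' : leftExt Δ[H] (s ▷ H ≫ mu H) ≫ mu H = piL H ▷ H ≫ mu H

lemma isAntipode_iff {s : H ⟶ H} :
    IsAntipode H s ↔ IsRightAntipode s ∧ IsLeftAntipode s := by
  have h4 : Δ[H] ▷ H ≫ (α_ H H H).hom ≫ (s ⊗ₘ mu H) ≫ mu H =
      leftExt Δ[H] (mu H) ≫ s ▷ H ≫ mu H := by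
    simp [leftExt, MonoidalCategory.tensorHom_def']
  have h5 : Δ[H] ▷ H ≫ (H ◁ s) ▷ H ≫ (α_ H H H).hom ≫ H ◁ mu H ≫ mu H =
      leftExt Δ[H] (s ▷ H ≫ mu H) ≫ mu H := by
    simp [leftExt]
  have h6 : H ◁ Δ[H] ≫ (α_ H H H).inv ≫ (mu H ⊗ₘ s) ≫ mu H =
      rightExt Δ[H] (mu H) ≫ H ◁ s ≫ mu H := by
    simp [rightExt, MonoidalCategory.tensorHom_def]
  have h7 : H ◁ Δ[H] ≫ H ◁ (s ▷ H) ≫ (α_ H H H).inv ≫ mu H ▷ H ≫ mu H =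
      rightExt Δ[H] (H ◁ s ≫ mu H) ≫ mu H := by
    simp [rightExt]
  constructor
  · rintro ⟨a, b, c, d, e4, e5, e6, e7⟩
    exact ⟨⟨a, b, c, d, h6 ▸ e6, h7 ▸ e7⟩, ⟨a, b, c, d, h4 ▸ e4, h5 ▸ e5⟩⟩
  · rintro ⟨⟨a, b, c, d, e6, e7⟩, ⟨-, -, -, -, e4, e5⟩⟩
    exact ⟨a, b, c, d, h4 ▸ e4, h5 ▸ e5, h6 ▸ e6, h7 ▸ e7⟩

/-- Uniqueness of inverses without associativity: `s = Π^R ∗ s = r ∗ (id ∗ s) = r ∗ Π^L = r`, where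
`hr.mul_mul` performs the only rebracketing. -/
lemma IsRightAntipode.eq {s r : H ⟶ H} (hs : IsRightAntipode s) (hr : IsLeftAntipode r) :
    s = r := by
  calc s = conv H (piR H) s := hs.piR_conv.symm
    _ = Δ[H] ≫ H ◁ s ≫ piR H ▷ H ≫ mu H := by
        rw [conv, MonoidalCategory.tensorHom_def', Category.assoc]
    _ = Δ[H] ≫ (H ◁ s ≫ Δ[H] ▷ H) ≫ (α_ H H H).hom ≫ H ◁ mu H ≫ r ▷ H ≫ mu H := by
        rw [← hr.mul_mul, leftExt]; simp only [Category.assoc]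
    _ = (Δ[H] ≫ Δ[H] ▷ H ≫ (α_ H H H).hom) ≫ H ◁ (H ◁ s ≫ mu H) ≫ r ▷ H ≫ mu H := by
        rw [whisker_exchange]; monoidal
    _ = Δ[H] ≫ H ◁ conv H (𝟙 H) s ≫ r ▷ H ≫ mu H := by
        rw [← ComonObj.comul_assoc, conv, MonoidalCategory.tensorHom_def]; simp
    _ = conv H r (piL H) := by
        rw [← hs.id_conv, conv, MonoidalCategory.tensorHom_def', Category.assoc]
    _ = r := hr.conv_piL

namespace AxiomsA123

lemma isRelativeInverse_of_isRightAntipode (h : AxiomsA123 H) {s : H ⟶ H}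
    (hs : IsRightAntipode s) :
    IsRelativeInverse (omegaL1 H) (omegaR1 H) (rightGalois H)
      (rightExt Δ[H] (H ◁ s ≫ mu H)) := by
  have h1 : rightGalois H ≫ rightExt Δ[H] (H ◁ s ≫ mu H) = omegaL1 H := by
    rw [rightGalois_eq, omegaL1, omegaOne_eq, rightExt_rightExt, whiskerLeft_id, Category.id_comp,
      hs.mul_mul]
  have h2 : rightExt Δ[H] (H ◁ s ≫ mu H) ≫ rightGalois H = omegaR1 H := by
    rw [rightGalois_eq, omegaR1, omegaOne_eq, rightExt_rightExt, whiskerLeft_id, Category.id_comp,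
      hs.mul_mul']
  have h3 : rightExt Δ[H] (H ◁ s ≫ mu H) ≫ omegaL1 H = rightExt Δ[H] (H ◁ s ≫ mu H) := by
    rw [omegaL1, omegaOne_eq, rightExt_rightExt, h.rightNuclear_piL.rightExt_comp, hs.conv_piL]
  -- The last field is formal: `Ω_R^1` then `φ` is `φ`, `β`, `φ` in turn, hence `φ` then `Ω_L^1`.
  exact ⟨h1, h2, h3, by rw [← h2, Category.assoc, h1, h3]⟩

lemma isRelativeInverse_of_isLeftAntipode (h : AxiomsA123 H) {s : H ⟶ H}
    (hs : IsLeftAntipode s) :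
    IsRelativeInverse (omegaR2 H) (omegaL2 H) (leftGalois H)
      (leftExt Δ[H] (s ▷ H ≫ mu H)) := by
  have h1 : leftGalois H ≫ leftExt Δ[H] (s ▷ H ≫ mu H) = omegaR2 H := by
    rw [leftGalois_eq, omegaR2, omegaTwo_eq, leftExt_leftExt, id_whiskerRight, Category.id_comp,
      hs.mul_mul]
  have h2 : leftExt Δ[H] (s ▷ H ≫ mu H) ≫ leftGalois H = omegaL2 H := by
    rw [leftGalois_eq, omegaL2, omegaTwo_eq, leftExt_leftExt, id_whiskerRight, Category.id_comp,
      hs.mul_mul']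
  have h3 : leftExt Δ[H] (s ▷ H ≫ mu H) ≫ omegaR2 H = leftExt Δ[H] (s ▷ H ≫ mu H) := by
    rw [omegaR2, omegaTwo_eq, leftExt_leftExt, h.leftNuclear_piR.leftExt_comp, hs.piR_conv]
  exact ⟨h1, h2, h3, by rw [← h2, Category.assoc, h1, h3]⟩

end AxiomsA123

lemma exists_isRightAntipode {φ : H ⊗ H ⟶ H ⊗ H}
    (hφ : IsRelativeInverse (omegaL1 H) (omegaR1 H) (rightGalois H) φ)
    (hl : AlmostLeftLinear H φ) : ∃ s : H ⟶ H, IsRightAntipode s := by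
  rw [omegaL1, omegaR1, rightGalois_eq, omegaOne_eq, omegaOne_eq] at hφ
  have e := eq_rightExt_of_isRelativeInverse hφ
  rw [hl.comp_whiskerLeft] at e
  -- The antipode candidate is `h ↦ (H ⊗ ε) φ(1 ⊗ h)`; colinearity and almost linearity make `φ` the
  -- extension of `x ⊗ y ↦ x s(y)`.
  generalize (λ_ H).inv ≫ eta H ▷ H ≫ φ ≫ H ◁ ε[H] ≫ (ρ_ H).hom = s at e
  subst e
  obtain ⟨h1, h2, h3, h4⟩ := hφ
  rw [rightExt_rightExt] at h1 h2 h3 h4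
  replace h1 := rightExt_injective h1
  replace h2 := rightExt_injective h2
  replace h3 := rightExt_injective h3
  replace h4 := rightExt_injective h4
  refine ⟨s, ?_, ?_, ?_, ?_, ?_, ?_⟩
  · rw [← one_rightExt, h1, one_whiskerLeft_mul]
  · rw [← one_rightExt, h2, one_whiskerLeft_mul]
  · rw [← one_rightExt, h3, one_whiskerLeft_mul]
  · rw [← one_rightExt, h4, one_whiskerLeft_mul]
  · simpa only [whiskerLeft_id, Category.id_comp] using h1
  · simpa only [whiskerLeft_id, Category.id_comp] using h2

lemma exists_isLeftAntipode {φ : H ⊗ H ⟶ H ⊗ H}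
    (hφ : IsRelativeInverse (omegaR2 H) (omegaL2 H) (leftGalois H) φ)
    (hl : AlmostRightLinear H φ) : ∃ s : H ⟶ H, IsLeftAntipode s := by
  rw [omegaL2, omegaR2, leftGalois_eq, omegaTwo_eq, omegaTwo_eq] at hφ
  have e := eq_leftExt_of_isRelativeInverse hφ
  rw [hl.comp_whiskerRight] at e
  generalize (ρ_ H).inv ≫ H ◁ eta H ≫ φ ≫ ε[H] ▷ H ≫ (λ_ H).hom = s at e
  subst e
  obtain ⟨h1, h2, h3, h4⟩ := hφ
  rw [leftExt_leftExt] at h1 h2 h3 h4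
  replace h1 := leftExt_injective h1
  replace h2 := leftExt_injective h2
  replace h3 := leftExt_injective h3
  replace h4 := leftExt_injective h4
  refine ⟨s, ?_, ?_, ?_, ?_, ?_, ?_⟩
  -- Evaluation at the unit on the right reverses convolution, so the four equations are used in a
  -- different order from the right-handed case.
  · rw [← one_leftExt, h2, one_whiskerRight_mul]
  · rw [← one_leftExt, h1, one_whiskerRight_mul]
  · rw [← one_leftExt, h4, one_whiskerRight_mul]
  · rw [← one_leftExt, h3, one_whiskerRight_mul]
  · simpa only [id_whiskerRight, Category.id_comp] using h1
  · simpa only [id_whiskerRight, Category.id_comp] using h2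

end Braided

end WeakHopfQuasigroup

theorem theorem2 {C : Type*} [Category* C] [MonoidalCategory C] [BraidedCategory C]
    [Limits.HasEqualizers C] [Limits.HasCoequalizers C]
    (H : C) [WeakHopfQuasigroup.UnitalMagmaObj H] [ComonObj H]
    (hH : WeakHopfQuasigroup.AxiomsA123 H) :
    (Nonempty (WeakHopfQuasigroup.Splitting (WeakHopfQuasigroup.omegaL1 H)) ∧
      Nonempty (WeakHopfQuasigroup.Splitting (WeakHopfQuasigroup.omegaR1 H)) ∧
      Nonempty (WeakHopfQuasigroup.Splitting (WeakHopfQuasigroup.omegaL2 H)) ∧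
      Nonempty (WeakHopfQuasigroup.Splitting (WeakHopfQuasigroup.omegaR2 H))) ∧
    ∀ (L1 : WeakHopfQuasigroup.Splitting (WeakHopfQuasigroup.omegaL1 H))
      (R1 : WeakHopfQuasigroup.Splitting (WeakHopfQuasigroup.omegaR1 H))
      (L2 : WeakHopfQuasigroup.Splitting (WeakHopfQuasigroup.omegaL2 H))
      (R2 : WeakHopfQuasigroup.Splitting (WeakHopfQuasigroup.omegaR2 H)),
      WeakHopfQuasigroup.IsWeakHopfQuasigroup H ↔
        ∃ (_ : IsIso (WeakHopfQuasigroup.fMor L1 R1))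
          (_ : IsIso (WeakHopfQuasigroup.gMor R2 L2)),
          WeakHopfQuasigroup.AlmostLeftLinear H
            (R1.q ≫ inv (WeakHopfQuasigroup.fMor L1 R1) ≫ L1.j) ∧
          WeakHopfQuasigroup.AlmostRightLinear H
            (L2.q ≫ inv (WeakHopfQuasigroup.gMor R2 L2) ≫ R2.j) := by
  refine ⟨⟨WeakHopfQuasigroup.nonempty_splitting _ hH.omegaL1_idem,
    WeakHopfQuasigroup.nonempty_splitting _ hH.omegaR1_idem,
    WeakHopfQuasigroup.nonempty_splitting _ hH.omegaL2_idem,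
    WeakHopfQuasigroup.nonempty_splitting _ hH.omegaR2_idem⟩, fun L1 R1 L2 R2 => ⟨?_, ?_⟩⟩
  · rintro ⟨-, s, hs⟩
    obtain ⟨hr, hl⟩ := WeakHopfQuasigroup.isAntipode_iff.1 hs
    obtain ⟨i1, e1⟩ := (hH.isRelativeInverse_of_isRightAntipode hr).isIso_and_eq L1 R1
    obtain ⟨i2, e2⟩ := (hH.isRelativeInverse_of_isLeftAntipode hl).isIso_and_eq R2 L2
    refine ⟨i1, i2, ?_, ?_⟩
    · exact e1.symm ▸ WeakHopfQuasigroup.almostLeftLinear_rightExt s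
    · exact e2.symm ▸ WeakHopfQuasigroup.almostRightLinear_leftExt s
  · rintro ⟨i1, i2, l1, l2⟩
    obtain ⟨s, hs⟩ := WeakHopfQuasigroup.exists_isRightAntipode
      (WeakHopfQuasigroup.isRelativeInverse_of_isIso (hi := i1) L1 R1 hH.omegaL1_rightGalois
        hH.rightGalois_omegaR1) l1
    obtain ⟨r, hr⟩ := WeakHopfQuasigroup.exists_isLeftAntipode
      (WeakHopfQuasigroup.isRelativeInverse_of_isIso (hi := i2) R2 L2 hH.omegaR2_leftGalois
        hH.leftGalois_omegaL2) l2
    obtain rfl := hs.eq hr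
    exact ⟨hH, s, WeakHopfQuasigroup.isAntipode_iff.2 ⟨hs, hr⟩⟩
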